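/- Let $m\ge 1$, write points of $\mathbb{R}^{m+1}$ as $z=(x_1,\dots,x_m,t)$, let $B_r(c)$ denote the open Euclidean ball of radius $r$ centred at $c$ in $\mathbb{R}^{m+1}$, and call $u$ a solution of the heat equation on an open set if it is $C^2$ there and $\sum_{j=1}^m \partial^2u/\partial x_j^2-\partial u/\partial t=0$. (i) There is a constant $a_m\ge 1$, depending only on $m$, such that $$\sup_{B_{r^2/4}(c)}|\partial^k u|\le \frac{a_m}{r^{2|k|}}\sup_{B_r(c)}|u|\qquad(|k|=1,2)$$ for all $0<r<1$, all $c\in\mathbb{R}^{m+1}$ and all solutions $u$ of the heat equation on an open set containing $\overline{B}_r(c)$. (ii) Let $a_m\ge 1$ be any constant as in (i), let $K$ be a real number, and let $F:B_1(0)\subset\mathbb{R}^{m+1}\to\mathbb{R}^{m+1}$ be a heat Bochner–Takahashi $K$-mapping, i.e. each of the $m+1$ components of $F$ is a solution of the heat equation on $B_1(0)$, and $$\max_{\|z\|\le r}\|F'(z)\|\le K\max_{\|z\|\le r}|\det F'(z)|^{1/(m+1)}\qquad\text{for all } 0\le r<1,$$ where $F'(z)$ is the Jacobian matrix and $\|A\|=\big(\sum_{i,j}|a_{ij}|^2\big)^{1/2}$.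 Suppose that $|\det F'(0)|=1$. Then $F$ covers a schlicht disk of radius at least $$\frac{0.22^4}{2^{m+5}\,m}\cdot\frac{1}{a_m^4K^{2m+3}},$$ that is, there are a domain (a nonempty connected open set) $\Omega\subset B_1(0)$ and an open ball $D$ of at least this radius such that $F$ maps $\Omega$ one-to-one onto $D$. -/

import Mathlib

noncomputable section

namespace HeatBloch

/-- Euclidean space-time `ℝ^(m+1)`, with points `z = (x₁, …, x_m, t)`; the coordinate with index
`Fin.last m` is the time `t`. -/
abbrev SpaceTime (m : ℕ) := EuclideanSpace ℝ (Fin (m + 1))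

/-- The first order partial derivative `∂_j u` at `z`. -/
def partialDeriv {m : ℕ} (j : Fin (m + 1)) (u : SpaceTime m → ℝ) (z : SpaceTime m) : ℝ :=
  fderiv ℝ u z (EuclideanSpace.single j 1)

/-- The heat operator `L u = ∑_{j ≤ m} ∂²u/∂x_j² - ∂u/∂t`. -/
def heatOperator {m : ℕ} (u : SpaceTime m → ℝ) (z : SpaceTime m) : ℝ :=
  (∑ j : Fin m, partialDeriv j.castSucc (partialDeriv j.castSucc u) z)
    - partialDeriv (Fin.last m) u z

/-- `u` is a (classical) solution of the heat equation on the set `Ω`, which is open wherever this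
is used. -/
structure SolvesHeatOn {m : ℕ} (u : SpaceTime m → ℝ) (Ω : Set (SpaceTime m)) : Prop where
  contDiffOn : ContDiffOn ℝ 2 u Ω
  heat_eq : ∀ z ∈ Ω, heatOperator u z = 0

/-- The Jacobian matrix `F'(z) = (∂F_i/∂x_j (z))_{i,j}`. -/
def jacobian {m : ℕ} (F : SpaceTime m → SpaceTime m) (z : SpaceTime m) :
    Matrix (Fin (m + 1)) (Fin (m + 1)) ℝ :=
  Matrix.of fun i j => partialDeriv j (fun w => F w i) z

/-- The norm `‖A‖ = (∑_{i,j} |a_ij|²)^(1/2)` of a square matrix. -/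
def frobeniusNorm {m : ℕ} (A : Matrix (Fin (m + 1)) (Fin (m + 1)) ℝ) : ℝ :=
  √(∑ i, ∑ j, |A i j| ^ 2)

/-- `F` is a heat Bochner–Takahashi `K`-mapping on the open unit ball. (The Jacobian is continuous
there, so the suprema below, over compact balls, are maxima.) -/
structure IsHeatBochnerTakahashi {m : ℕ} (K : ℝ) (F : SpaceTime m → SpaceTime m) : Prop where
  solvesHeat : ∀ i : Fin (m + 1), SolvesHeatOn (fun z => F z i) (Metric.ball 0 1)
  takahashi : ∀ r : ℝ, 0 ≤ r → r < 1 →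
    sSup ((fun z => frobeniusNorm (jacobian F z)) '' Metric.closedBall 0 r) ≤
      K * sSup ((fun z => |(jacobian F z).det| ^ (1 / ((m : ℝ) + 1))) '' Metric.closedBall 0 r)

/-- `F` covers a schlicht disk of radius `R`: it maps some subdomain of the unit ball one-to-one
onto an open ball of radius `R`. -/
def CoversSchlichtDisk {m : ℕ} (F : SpaceTime m → SpaceTime m) (R : ℝ) : Prop :=
  ∃ (Ω : Set (SpaceTime m)) (w : SpaceTime m), Ω ⊆ Metric.ball 0 1 ∧ IsOpen Ω ∧ IsConnected Ω ∧
    Set.BijOn F Ω (Metric.ball w R)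

/-- `a ≥ 1` is a constant for which the interior derivative estimates of orders one and two
`sup_{B_{r²/4}(c)} |∂^k u| ≤ a / r^(2|k|) * sup_{B_r(c)} |u|`, `|k| = 1, 2`,
hold for all `0 < r < 1` and all solutions `u` of the heat equation on an open set that contains
the closed ball of radius `r` centred at `c` in `ℝ^(m+1)`. The supremum on the right is written
through its upper bounds `C`. -/
structure IsInteriorEstimateConstant (m : ℕ) (a : ℝ) : Prop where
  one_le : 1 ≤ a
  first_order : ∀ (Ω : Set (SpaceTime m)) (u : SpaceTime m → ℝ) (c : SpaceTime m) (r C : ℝ),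
    IsOpen Ω → SolvesHeatOn u Ω → 0 < r → r < 1 → Metric.closedBall c r ⊆ Ω →
    (∀ z ∈ Metric.ball c r, |u z| ≤ C) →
    ∀ z ∈ Metric.ball c (r ^ 2 / 4), ∀ j : Fin (m + 1),
      |partialDeriv j u z| ≤ a / r ^ 2 * C
  second_order : ∀ (Ω : Set (SpaceTime m)) (u : SpaceTime m → ℝ) (c : SpaceTime m) (r C : ℝ),
    IsOpen Ω → SolvesHeatOn u Ω → 0 < r → r < 1 → Metric.closedBall c r ⊆ Ω →
    (∀ z ∈ Metric.ball c r, |u z| ≤ C) →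
    ∀ z ∈ Metric.ball c (r ^ 2 / 4), ∀ i j : Fin (m + 1),
      |partialDeriv i (partialDeriv j u) z| ≤ a / r ^ 4 * C

end HeatBloch

end

open HeatBloch

/-!
The proof of the existence of `a` is Bernstein's method, which needs nothing but the maximum
principle. For a smooth solution `u` and a quadratic cutoff `η` supported in the parabolic ellipsoid
`|x - c|² / ρ² + (t - c_t)² / ρ⁴ ≤ 1`, the function `η² (∂ⱼu)² + λ u²` with `λ = (15 + 2m) / ρ²`
satisfies a differential inequality which forces `∂ⱼu = 0` at an interior maximum point
(`partialDeriv_eq_zero_of_isLocalMax_bernstein`). Hence `|∂ⱼu(c)|` is at most a constant times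
`sup |u| / ρ` for each spatial direction `j` (`abs_partialDeriv_le_of_heat`). Derivatives of smooth
solutions are solutions and `∂u/∂t` is the spatial Laplacian, so iteration on concentric balls bounds
all derivatives of order at most two (`abs_partialDeriv_le`, used twice). A classical solution is
localized and mollified, and the bounds pass to the limit (`exists_smooth_approximation`).

The schlicht disk comes from Landau's rescaling. Let `z₀` maximize
`(1/2 - ‖z‖)³ |det F'(z)|^(1/(m+1))` on the closed ball of radius `1/2`, let `M` be the value of
`|det F'|^(1/(m+1))` at `z₀`, and let `s = (1/2 - ‖z₀‖) / 2`. Then `s³ M ≥ 1/64`, and the Takahashi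
condition gives `‖F'(z₀)‖ ≤ K M` and `‖F'‖ ≤ 8 K M` on the ball `B_s(z₀)`. By Hadamard's inequality
(`abs_det_mul_norm_le`) `F'(z₀)` expands lengths by at least `M / K^m`, and by the second order
interior estimates `F'` is Lipschitz on `B_{s²/4}(z₀)`, with constant `8 (m+1)² a K M / s³`. The
quantitative inverse function theorem (`exists_bijOn_ball_of_fderiv_near`) then yields a schlicht
disk of radius at least `1 / (4096 (m+1)² a K^(2m+1))`. This is more than claimed, since `a ≥ 1`,
`K ≥ 1` and `(m+1)² ≤ m 2^(m+1)`.
-/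

namespace HeatBloch

open Metric Set Filter Topology
open scoped ContDiff

variable {m : ℕ}

/-! ### Calculus of partial derivatives -/

lemma partialDeriv_congr {u v : SpaceTime m → ℝ} {z : SpaceTime m} (j : Fin (m + 1))
    (h : u =ᶠ[𝓝 z] v) : partialDeriv j u z = partialDeriv j v z := by
  simp only [partialDeriv, h.fderiv_eq]

lemma partialDeriv_congr_eventually {u v : SpaceTime m → ℝ} {z : SpaceTime m} (j : Fin (m + 1))
    (h : u =ᶠ[𝓝 z] v) : partialDeriv j u =ᶠ[𝓝 z] partialDeriv j v :=
  h.eventuallyEq_nhds.mono fun _ hy => partialDeriv_congr j hy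

lemma partialDeriv_const (j : Fin (m + 1)) (c : ℝ) (z : SpaceTime m) :
    partialDeriv j (fun _ => c) z = 0 := by
  simp [partialDeriv]

lemma partialDeriv_add (j : Fin (m + 1)) {f g : SpaceTime m → ℝ} {z : SpaceTime m}
    (hf : DifferentiableAt ℝ f z) (hg : DifferentiableAt ℝ g z) :
    partialDeriv j (fun z => f z + g z) z = partialDeriv j f z + partialDeriv j g z := by
  simp [partialDeriv, fderiv_fun_add hf hg]

lemma partialDeriv_sum {ι : Type*} (s : Finset ι) (j : Fin (m + 1)) {f : ι → SpaceTime m → ℝ}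
    {z : SpaceTime m} (hf : ∀ i ∈ s, DifferentiableAt ℝ (f i) z) :
    partialDeriv j (fun z => ∑ i ∈ s, f i z) z = ∑ i ∈ s, partialDeriv j (f i) z := by
  simp [partialDeriv, fderiv_fun_sum hf]

lemma partialDeriv_sub_const (j : Fin (m + 1)) (f : SpaceTime m → ℝ) (c : ℝ) (z : SpaceTime m) :
    partialDeriv j (fun z => f z - c) z = partialDeriv j f z := by
  simp only [partialDeriv, fderiv_sub_const]

lemma partialDeriv_mul (j : Fin (m + 1)) {f g : SpaceTime m → ℝ} {z : SpaceTime m}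
    (hf : DifferentiableAt ℝ f z) (hg : DifferentiableAt ℝ g z) :
    partialDeriv j (fun z => f z * g z) z = partialDeriv j f z * g z + f z * partialDeriv j g z := by
  simp [partialDeriv, fderiv_fun_mul hf hg]
  ring

lemma partialDeriv_const_mul (j : Fin (m + 1)) (c : ℝ) {f : SpaceTime m → ℝ} {z : SpaceTime m}
    (hf : DifferentiableAt ℝ f z) :
    partialDeriv j (fun z => c * f z) z = c * partialDeriv j f z := by
  rw [partialDeriv_mul j (by fun_prop) hf, partialDeriv_const]; ring

lemma partialDeriv_coord (j i : Fin (m + 1)) (z : SpaceTime m) :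
    partialDeriv j (fun z => z i) z = if i = j then 1 else 0 := by
  have : HasFDerivAt (fun z : SpaceTime m => z i)
      (EuclideanSpace.proj i : SpaceTime m →L[ℝ] ℝ) z :=
    (EuclideanSpace.proj i : SpaceTime m →L[ℝ] ℝ).hasFDerivAt
  simp [partialDeriv, this.fderiv]

lemma contDiff_partialDeriv {u : SpaceTime m → ℝ} {k n : WithTop ℕ∞} (hu : ContDiff ℝ n u)
    (hk : k + 1 ≤ n) (j : Fin (m + 1)) : ContDiff ℝ k (partialDeriv j u) :=
  (hu.fderiv_right hk).clm_apply contDiff_const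

lemma contDiffAt_partialDeriv {u : SpaceTime m → ℝ} {z : SpaceTime m} {k n : WithTop ℕ∞}
    (hu : ContDiffAt ℝ n u z) (hk : k + 1 ≤ n) (j : Fin (m + 1)) :
    ContDiffAt ℝ k (partialDeriv j u) z :=
  (hu.fderiv_right hk).clm_apply contDiffAt_const

lemma partialDeriv_comm {u : SpaceTime m → ℝ} (hu : ContDiff ℝ 2 u) (i j : Fin (m + 1))
    (z : SpaceTime m) :
    partialDeriv i (partialDeriv j u) z = partialDeriv j (partialDeriv i u) z := by
  have hd : DifferentiableAt ℝ (fderiv ℝ u) z :=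
    (hu.fderiv_right (m := 1) (by norm_num)).differentiable (by norm_num) z
  have key : ∀ i j, partialDeriv i (partialDeriv j u) z =
      fderiv ℝ (fderiv ℝ u) z (EuclideanSpace.single i 1) (EuclideanSpace.single j 1) := by
    intro i j
    have : partialDeriv j u = fun w => fderiv ℝ u w (EuclideanSpace.single j 1) := rfl
    rw [partialDeriv, this, fderiv_clm_apply hd (by fun_prop)]
    simp
  rw [key, key]
  exact hu.contDiffAt.isSymmSndFDerivAt (by simp) _ _

lemma partialDeriv_partialDeriv_mul {f g : SpaceTime m → ℝ} (hf : ContDiff ℝ 2 f)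
    (hg : ContDiff ℝ 2 g) (j : Fin (m + 1)) (z : SpaceTime m) :
    partialDeriv j (partialDeriv j fun z => f z * g z) z =
      partialDeriv j (partialDeriv j f) z * g z + 2 * (partialDeriv j f z * partialDeriv j g z) +
        f z * partialDeriv j (partialDeriv j g) z := by
  have hfd : Differentiable ℝ f := hf.differentiable (by norm_num)
  have hfd' : Differentiable ℝ (partialDeriv j f) :=
    (contDiff_partialDeriv (k := 1) hf (by norm_num) j).differentiable (by norm_num)
  have hgd : Differentiable ℝ g := hg.differentiable (by norm_num)
  have hgd' : Differentiable ℝ (partialDeriv j g) :=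
    (contDiff_partialDeriv (k := 1) hg (by norm_num) j).differentiable (by norm_num)
  have : partialDeriv j (fun z => f z * g z) =
      fun z => partialDeriv j f z * g z + f z * partialDeriv j g z :=
    funext fun z => partialDeriv_mul j (hfd z) (hgd z)
  rw [this, partialDeriv_add j ((hfd' z).fun_mul (hgd z)) ((hfd z).fun_mul (hgd' z)),
    partialDeriv_mul j (hfd' z) (hgd z), partialDeriv_mul j (hfd z) (hgd' z)]
  ring

lemma partialDeriv_partialDeriv_sq {f : SpaceTime m → ℝ} (hf : ContDiff ℝ 2 f) (j : Fin (m + 1))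
    (z : SpaceTime m) :
    partialDeriv j (partialDeriv j fun z => f z * f z) z =
      2 * partialDeriv j f z ^ 2 + 2 * (f z * partialDeriv j (partialDeriv j f) z) := by
  rw [partialDeriv_partialDeriv_mul hf hf]; ring

lemma partialDeriv_eq_zero_of_isLocalMax {f : SpaceTime m → ℝ} {p : SpaceTime m}
    (h : IsLocalMax f p) (j : Fin (m + 1)) : partialDeriv j f p = 0 := by
  simp [partialDeriv, h.fderiv_eq_zero]

lemma partialDeriv_partialDeriv_nonpos_of_isLocalMax {f : SpaceTime m → ℝ} (hf : ContDiff ℝ 2 f)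
    {p : SpaceTime m} (h : IsLocalMax f p) (j : Fin (m + 1)) :
    partialDeriv j (partialDeriv j f) p ≤ 0 := by
  have line : ∀ g : SpaceTime m → ℝ, Differentiable ℝ g →
      deriv (fun s : ℝ => g (p + s • EuclideanSpace.single j 1)) =
        fun s => partialDeriv j g (p + s • EuclideanSpace.single j 1) := by
    intro g hg
    funext s
    have h1 : HasDerivAt (fun s : ℝ => p + s • (EuclideanSpace.single j 1 : SpaceTime m))
        (EuclideanSpace.single j 1) s := by
      simpa using ((hasDerivAt_id s).smul_const
        (EuclideanSpace.single j 1 : SpaceTime m)).const_add p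
    exact ((hg _).hasFDerivAt.comp_hasDerivAt s h1).deriv
  have hd : Differentiable ℝ f := hf.differentiable (by norm_num)
  have hd' : Differentiable ℝ (partialDeriv j f) :=
    (contDiff_partialDeriv (k := 1) hf (by norm_num) j).differentiable (by norm_num)
  have hcont : Continuous fun s : ℝ => p + s • (EuclideanSpace.single j 1 : SpaceTime m) := by
    fun_prop
  have hmax : IsLocalMax (fun s : ℝ => f (p + s • EuclideanSpace.single j 1)) 0 := by
    have := hcont.tendsto 0
    simp only [zero_smul, add_zero] at this
    simpa [IsLocalMax, IsMaxFilter] using this.eventually h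
  by_contra! hpos
  have hdd : deriv (deriv fun s : ℝ => f (p + s • EuclideanSpace.single j 1)) 0 =
      partialDeriv j (partialDeriv j f) p := by
    rw [line f hd, line _ hd']; simp
  have hmin : IsLocalMin (fun s : ℝ => f (p + s • EuclideanSpace.single j 1)) 0 :=
    isLocalMin_of_deriv_deriv_pos (hdd ▸ hpos) hmax.deriv_eq_zero
      (hd.continuous.comp hcont).continuousAt
  -- A local maximum that is also a local minimum: the function is locally constant.
  have hconst : (fun s : ℝ => f (p + s • EuclideanSpace.single j 1)) =ᶠ[𝓝 0]
      fun _ => f (p + (0 : ℝ) • EuclideanSpace.single j 1) := by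
    filter_upwards [hmax, hmin] with s h1 h2 using le_antisymm h1 h2
  rw [hconst.deriv.deriv_eq] at hdd
  simp at hdd
  exact hpos.ne hdd

/-! ### The interior gradient estimate for smooth solutions -/

lemma contDiff_coord (i : Fin (m + 1)) {n : WithTop ℕ∞} :
    ContDiff ℝ n fun z : SpaceTime m => z i :=
  (EuclideanSpace.proj i : SpaceTime m →L[ℝ] ℝ).contDiff

/-- The quadratic cutoff `1 - ∑ᵢ wᵢ (zᵢ - cᵢ)²`, positive on an ellipsoid centred at `c`. -/
def quadraticCutoff (w : Fin (m + 1) → ℝ) (c z : SpaceTime m) : ℝ :=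
  1 - ∑ i, w i * (z i - c i) ^ 2

lemma contDiff_quadraticCutoff (w : Fin (m + 1) → ℝ) (c : SpaceTime m) {n : WithTop ℕ∞} :
    ContDiff ℝ n (quadraticCutoff w c) :=
  contDiff_const.sub <| ContDiff.sum fun i _ =>
    contDiff_const.mul (((contDiff_coord i).sub contDiff_const).pow 2)

lemma partialDeriv_quadraticCutoff (w : Fin (m + 1) → ℝ) (c : SpaceTime m) (j : Fin (m + 1)) :
    partialDeriv j (quadraticCutoff w c) = fun z => -2 * w j * (z j - c j) := by
  funext z
  have hd : ∀ i, DifferentiableAt ℝ (fun z : SpaceTime m => z i) z := fun i =>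
    (contDiff_coord (n := 1) i).differentiable (by norm_num) z
  have hd' : ∀ i, DifferentiableAt ℝ (fun z : SpaceTime m => z i - c i) z := fun i =>
    (hd i).sub_const _
  have hform : quadraticCutoff w c =
      fun z => -1 * (∑ i, w i * ((z i - c i) * (z i - c i))) - (-1) := by
    funext z; simp only [quadraticCutoff, pow_two]; ring
  rw [hform, partialDeriv_sub_const, partialDeriv_const_mul, partialDeriv_sum]
  · have : ∀ i, partialDeriv j (fun z : SpaceTime m => w i * ((z i - c i) * (z i - c i))) z =
        if i = j then 2 * w j * (z j - c j) else 0 := by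
      intro i
      rw [partialDeriv_const_mul _ _ ((hd' i).fun_mul (hd' i)),
        partialDeriv_mul _ (hd' i) (hd' i), partialDeriv_sub_const, partialDeriv_coord]
      split_ifs with h
      · subst h; ring
      · ring
    simp only [this, Finset.sum_ite_eq', Finset.mem_univ, if_true]
    ring
  · exact fun i _ => ((hd' i).fun_mul (hd' i)).const_mul _
  · exact DifferentiableAt.fun_sum fun i _ => ((hd' i).fun_mul (hd' i)).const_mul _

lemma partialDeriv_partialDeriv_quadraticCutoff (w : Fin (m + 1) → ℝ) (c : SpaceTime m)
    (j : Fin (m + 1)) (z : SpaceTime m) :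
    partialDeriv j (partialDeriv j (quadraticCutoff w c)) z = -2 * w j := by
  have hd : DifferentiableAt ℝ (fun z : SpaceTime m => z j) z :=
    (contDiff_coord (n := 1) j).differentiable (by norm_num) z
  rw [partialDeriv_quadraticCutoff, partialDeriv_const_mul _ _ (hd.sub_const _),
    partialDeriv_sub_const, partialDeriv_coord]
  simp

/-- The spatial derivatives of a smooth solution are again solutions. -/
lemma heatOperator_partialDeriv_eq_zero {u : SpaceTime m → ℝ} (hu : ContDiff ℝ ∞ u)
    {U : Set (SpaceTime m)} (hU : IsOpen U) (hheat : ∀ z ∈ U, heatOperator u z = 0)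
    (j : Fin (m + 1)) : ∀ z ∈ U, heatOperator (partialDeriv j u) z = 0 := by
  intro z hz
  have hu' : ∀ i, ContDiff ℝ ∞ (partialDeriv i u) := fun i =>
    contDiff_partialDeriv hu (by simp) i
  have hu'' : ∀ i k, ContDiff ℝ ∞ (partialDeriv k (partialDeriv i u)) := fun i k =>
    contDiff_partialDeriv (hu' i) (by simp) k
  have htwo : ∀ {f : SpaceTime m → ℝ}, ContDiff ℝ ∞ f → ContDiff ℝ 2 f := fun h =>
    contDiff_infty.1 h 2
  have hev : partialDeriv (Fin.last m) u =ᶠ[𝓝 z]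
      fun w => ∑ i : Fin m, partialDeriv i.castSucc (partialDeriv i.castSucc u) w := by
    filter_upwards [hU.mem_nhds hz] with w hw
    have := hheat w hw
    unfold heatOperator at this
    linarith
  have h1 := partialDeriv_congr j hev
  rw [partialDeriv_sum _ _ fun i _ => (hu'' _ _).differentiable (by simp) z] at h1
  unfold heatOperator
  rw [partialDeriv_comm (htwo hu), h1, sub_eq_zero]
  refine Finset.sum_congr rfl fun i _ => ?_
  have : partialDeriv i.castSucc (partialDeriv j u) = partialDeriv j (partialDeriv i.castSucc u) :=
    funext fun w => partialDeriv_comm (htwo hu) _ _ w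
  rw [this, partialDeriv_comm (htwo (hu' _))]

/-- The differential inequality behind Bernstein's method: at an interior local maximum of
`η² (∂ⱼu)² + λ u²`, with `λ` dominating the derivatives of the cutoff `η`, the spatial derivative
`∂ⱼu` vanishes. -/
lemma partialDeriv_eq_zero_of_isLocalMax_bernstein {u η : SpaceTime m → ℝ} (hu : ContDiff ℝ ∞ u)
    (hη : ContDiff ℝ 2 η) {U : Set (SpaceTime m)} (hU : IsOpen U)
    (hheat : ∀ z ∈ U, heatOperator u z = 0) {p : SpaceTime m} (hp : p ∈ U) (j : Fin m) {l : ℝ}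
    (hlnn : 0 ≤ l)
    (hl : 3 * ∑ i : Fin m, partialDeriv i.castSucc η p ^ 2 - η p * heatOperator η p < l)
    (hmax : IsLocalMax (fun z => (η z * partialDeriv j.castSucc u z) *
      (η z * partialDeriv j.castSucc u z) + l * (u z * u z)) p) :
    partialDeriv j.castSucc u p = 0 := by
  have htwo : ∀ {f : SpaceTime m → ℝ}, ContDiff ℝ ∞ f → ContDiff ℝ 2 f := fun h =>
    contDiff_infty.1 h 2
  set v := partialDeriv j.castSucc u with hv
  have hv2 : ContDiff ℝ 2 v := htwo (contDiff_partialDeriv hu (by simp) _)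
  have hu2 : ContDiff ℝ 2 u := htwo hu
  have hd : ∀ {f : SpaceTime m → ℝ}, ContDiff ℝ 2 f → Differentiable ℝ f := fun h =>
    h.differentiable (by norm_num)
  have hd' : ∀ {f : SpaceTime m → ℝ} (i : Fin (m + 1)), ContDiff ℝ 2 f →
      Differentiable ℝ (partialDeriv i f) := fun i h =>
    (contDiff_partialDeriv (k := 1) h (by norm_num) i).differentiable (by norm_num)
  have hf2 : ContDiff ℝ 2 fun z => η z * v z := hη.mul hv2
  have hff : ContDiff ℝ 2 fun z => (η z * v z) * (η z * v z) := hf2.mul hf2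
  have huu : ContDiff ℝ 2 fun z => u z * u z := hu2.mul hu2
  have hluu : ContDiff ℝ 2 fun z => l * (u z * u z) := contDiff_const.mul huu
  -- First derivatives of the auxiliary function.
  have hfirst : ∀ i, partialDeriv i (fun z => (η z * v z) * (η z * v z) + l * (u z * u z)) =
      fun z => partialDeriv i (fun z => (η z * v z) * (η z * v z)) z +
        l * partialDeriv i (fun z => u z * u z) z := fun i => funext fun z => by
    rw [partialDeriv_add i (hd hff z) (hd hluu z), partialDeriv_const_mul i l (hd huu z)]
  have htime : 2 * (η p * v p) * (partialDeriv (Fin.last m) η p * v p +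
      η p * partialDeriv (Fin.last m) v p) + 2 * l * (u p * partialDeriv (Fin.last m) u p) = 0 := by
    have := partialDeriv_eq_zero_of_isLocalMax hmax (Fin.last m)
    rw [hfirst] at this
    simp only [partialDeriv_mul _ (hd hf2 p) (hd hf2 p), partialDeriv_mul _ (hd hη p) (hd hv2 p),
      partialDeriv_mul _ (hd hu2 p) (hd hu2 p)] at this
    linarith
  have hspace : ∀ i : Fin (m + 1),
      2 * (partialDeriv i η p * v p + η p * partialDeriv i v p) ^ 2 +
        2 * (η p * v p * (partialDeriv i (partialDeriv i η) p * v p +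
          2 * (partialDeriv i η p * partialDeriv i v p) +
          η p * partialDeriv i (partialDeriv i v) p)) +
        l * (2 * partialDeriv i u p ^ 2 + 2 * (u p * partialDeriv i (partialDeriv i u) p)) ≤ 0 := by
    intro i
    have := partialDeriv_partialDeriv_nonpos_of_isLocalMax (hff.add hluu) hmax i
    rw [hfirst, partialDeriv_add i (hd' i hff p) ((hd' i huu p).const_mul l),
      partialDeriv_const_mul i l (hd' i huu p), partialDeriv_partialDeriv_sq hf2,
      partialDeriv_partialDeriv_sq hu2, partialDeriv_partialDeriv_mul hη hv2,
      partialDeriv_mul i (hd hη p) (hd hv2 p)] at this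
    exact this
  -- Absorb the mixed terms `8 η ηᵢ v vᵢ` by completing the square.
  have hbelow : ∀ i : Fin m,
      v p ^ 2 * (-6 * partialDeriv i.castSucc η p ^ 2 +
        2 * η p * partialDeriv i.castSucc (partialDeriv i.castSucc η) p) +
        2 * (η p ^ 2 * v p) * partialDeriv i.castSucc (partialDeriv i.castSucc v) p +
        2 * l * partialDeriv i.castSucc u p ^ 2 +
        2 * l * u p * partialDeriv i.castSucc (partialDeriv i.castSucc u) p ≤ 0 := by
    intro i
    nlinarith [hspace i.castSucc, sq_nonneg (η p * partialDeriv i.castSucc v p +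
      2 * (partialDeriv i.castSucc η p * v p))]
  have hsum := Finset.sum_nonpos fun i (_ : i ∈ Finset.univ) => hbelow i
  simp only [Finset.sum_add_distrib, ← Finset.mul_sum] at hsum
  have hheatu := hheat p hp
  have hheatv := heatOperator_partialDeriv_eq_zero hu hU hheat j.castSucc p hp
  rw [← hv] at hheatv
  have hl0 : v p ^ 2 ≤ ∑ i : Fin m, partialDeriv i.castSucc u p ^ 2 :=
    Finset.single_le_sum (f := fun i : Fin m => partialDeriv i.castSucc u p ^ 2)
      (fun i _ => sq_nonneg _) (Finset.mem_univ j)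
  unfold heatOperator at hheatu hheatv hl
  by_contra hne
  have hpos : 0 < v p ^ 2 := by positivity
  nlinarith [mul_le_mul_of_nonneg_left hl0 hlnn, mul_pos hpos (sub_pos.2 hl),
    congrArg (fun x => η p ^ 2 * v p * x) hheatv, congrArg (fun x => l * u p * x) hheatu]

/-- Bernstein's interior gradient estimate for smooth solutions of the heat equation. -/
lemma abs_partialDeriv_le_of_heat {u : SpaceTime m → ℝ} (hu : ContDiff ℝ ∞ u) {c : SpaceTime m}
    {ρ C : ℝ} (hρ : 0 < ρ) (hρ1 : ρ ≤ 1) (hheat : ∀ z ∈ ball c ρ, heatOperator u z = 0)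
    (hC : ∀ z ∈ closedBall c ρ, |u z| ≤ C) (j : Fin m) :
    |partialDeriv j.castSucc u c| ≤ (15 + 2 * m) / ρ * C := by
  set w : Fin (m + 1) → ℝ := fun i => if i = Fin.last m then 1 / ρ ^ 4 else 1 / ρ ^ 2 with hw
  have hw0 : ∀ i, 0 ≤ w i := fun i => by simp only [hw]; split_ifs <;> positivity
  have hρ2 : ρ ^ 2 ≤ 1 := pow_le_one₀ hρ.le hρ1
  have hwρ : ∀ i, 1 ≤ ρ ^ 2 * w i := fun i => by
    simp only [hw]
    split_ifs
    · rw [show ρ ^ 2 * (1 / ρ ^ 4) = 1 / ρ ^ 2 by field_simp]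
      exact (one_le_div (by positivity)).2 hρ2
    · rw [mul_one_div_cancel (by positivity)]
  set η := quadraticCutoff w c with hηdef
  have hη : ContDiff ℝ 2 η := contDiff_quadraticCutoff w c
  have hdist : ∀ z, dist z c ^ 2 ≤ ρ ^ 2 * (1 - η z) := by
    intro z
    rw [EuclideanSpace.dist_eq, Real.sq_sqrt (by positivity), hηdef, quadraticCutoff,
      sub_sub_cancel, Finset.mul_sum]
    refine Finset.sum_le_sum fun i _ => ?_
    rw [Real.dist_eq, sq_abs]
    nlinarith [mul_le_mul_of_nonneg_right (hwρ i) (sq_nonneg (z i - c i))]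
  set S : Set (SpaceTime m) := {z | 0 ≤ η z} with hS
  have hSsub : S ⊆ closedBall c ρ := fun z hz => by
    have hz' : 0 ≤ η z := hz
    have : dist z c ^ 2 ≤ ρ ^ 2 := (hdist z).trans (by nlinarith [sq_nonneg ρ])
    exact mem_closedBall.2 (abs_le_of_sq_le_sq' this hρ.le).2
  have hScomp : IsCompact S := (isCompact_closedBall c ρ).of_isClosed_subset
    (isClosed_le continuous_const hη.continuous) hSsub
  have hηc : η c = 1 := by simp [hηdef, quadraticCutoff]
  have hcS : c ∈ S := by simp [hS, hηc]
  set v := partialDeriv j.castSucc u with hv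
  set l : ℝ := (15 + 2 * m) / ρ ^ 2 with hl
  have hl0 : 0 < l := by positivity
  have hvc : Continuous v := (contDiff_partialDeriv (k := ∞) hu (by simp) _).continuous
  set P : SpaceTime m → ℝ := fun z => (η z * v z) * (η z * v z) + l * (u z * u z) with hP
  have hPc : Continuous P := by
    have := hη.continuous
    have := hu.continuous
    fun_prop
  obtain ⟨p, hpS, hpmax⟩ := hScomp.exists_isMaxOn ⟨c, hcS⟩ hPc.continuousOn
  have hp0 : 0 ≤ η p := hpS
  -- At the maximum point only the zeroth order term survives.
  have hzero : η p * v p = 0 := by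
    rcases hp0.eq_or_lt with h0 | h0
    · rw [← h0, zero_mul]
    · have hpball : p ∈ ball c ρ := by
        have : dist p c ^ 2 < ρ ^ 2 := (hdist p).trans_lt (by nlinarith [pow_pos hρ 2])
        exact mem_ball.2 (abs_lt_of_sq_lt_sq' this hρ.le).2
      have hSn : S ∈ 𝓝 p :=
        mem_of_superset ((isOpen_lt continuous_const hη.continuous).mem_nhds h0)
          fun _ hz => (mem_ofPred.1 hz).le
      have hp1 : η p ≤ 1 := by
        rw [hηdef, quadraticCutoff]
        have := Finset.sum_nonneg fun i (_ : i ∈ Finset.univ) =>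
          mul_nonneg (hw0 i) (sq_nonneg (p i - c i))
        linarith
      rw [hv, partialDeriv_eq_zero_of_isLocalMax_bernstein hu hη isOpen_ball hheat hpball j hl0.le ?_
        (hpmax.isLocalMax hSn), mul_zero]
      have hq : ∑ i : Fin m, w i.castSucc * (p i.castSucc - c i.castSucc) ^ 2 +
          w (Fin.last m) * (p (Fin.last m) - c (Fin.last m)) ^ 2 ≤ 1 := by
        rw [hηdef, quadraticCutoff, Fin.sum_univ_castSucc] at hp0
        linarith
      unfold heatOperator
      simp only [hηdef, partialDeriv_partialDeriv_quadraticCutoff]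
      simp only [partialDeriv_quadraticCutoff]
      rw [← hηdef]
      have hws : ∀ i : Fin m, w i.castSucc = 1 / ρ ^ 2 := fun i => by
        simp [hw, Fin.castSucc_ne_last]
      have hwl : w (Fin.last m) = 1 / ρ ^ 4 := by simp [hw]
      simp only [hws, hwl, ← Finset.mul_sum, mul_pow, Finset.sum_const, Finset.card_univ,
        Fintype.card_fin, nsmul_eq_mul] at hq ⊢
      set X := ∑ i : Fin m, (p i.castSucc - c i.castSucc) ^ 2
      set T := p (Fin.last m) - c (Fin.last m)
      have hX : 1 / ρ ^ 2 * X ≤ 1 := by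
        have : 0 ≤ 1 / ρ ^ 4 * T ^ 2 := by positivity
        linarith
      have hT : |T| ≤ ρ ^ 2 := by
        have hX0 : 0 ≤ X := Finset.sum_nonneg fun i _ => sq_nonneg _
        have h1 : 0 ≤ 1 / ρ ^ 2 * X := by positivity
        have h2 : 1 / ρ ^ 4 * T ^ 2 ≤ 1 := by linarith
        rw [one_div_mul_eq_div, div_le_one (by positivity)] at h2
        exact abs_le_of_sq_le_sq (by nlinarith) (by positivity)
      have hT' : |1 / ρ ^ 4 * T| ≤ 1 / ρ ^ 2 := by
        rw [abs_mul, abs_of_pos (by positivity)]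
        calc 1 / ρ ^ 4 * |T| ≤ 1 / ρ ^ 4 * ρ ^ 2 := by gcongr
          _ = 1 / ρ ^ 2 := by field_simp
      have ha : 0 < 1 / ρ ^ 2 := by positivity
      have hl' : l = (15 + 2 * m) * (1 / ρ ^ 2) := by rw [hl]; ring
      rw [hl']
      set a := 1 / ρ ^ 2
      set b := 1 / ρ ^ 4 * T with hb
      have h1 : a * (a * X) ≤ a * 1 := by gcongr
      have h2 : η p * (m * a) ≤ 1 * (m * a) := by gcongr
      have h3 : -(η p * b) ≤ a := by
        have := abs_le.1 hT'
        nlinarith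
      calc _ = 12 * (a * (a * X)) + 2 * (η p * (m * a)) + 2 * -(η p * b) := by rw [hb]; ring
        _ ≤ 12 * (a * 1) + 2 * (1 * (m * a)) + 2 * a := by gcongr
        _ < _ := by nlinarith
  have hC0 : 0 ≤ C := (abs_nonneg _).trans (hC c (mem_closedBall_self hρ.le))
  have hle : v c * v c ≤ l * (C * C) := by
    have h1 : P c ≤ P p := hpmax hcS
    simp only [hP, hηc, one_mul, hzero, mul_zero, zero_add] at h1
    have h2 : u p * u p ≤ C * C := by
      rw [← abs_mul_abs_self (u p)]
      exact mul_self_le_mul_self (abs_nonneg _) (hC p (hSsub hpS))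
    nlinarith [mul_self_nonneg (u c), mul_le_mul_of_nonneg_left h2 hl0.le]
  refine abs_le_of_sq_le_sq ?_ (by positivity)
  calc v c ^ 2 ≤ l * (C * C) := by rw [pow_two]; exact hle
    _ = (15 + 2 * m) * (C / ρ) ^ 2 := by rw [hl]; field_simp
    _ ≤ (15 + 2 * m) ^ 2 * (C / ρ) ^ 2 := by
        gcongr
        nlinarith [Nat.cast_nonneg (α := ℝ) m]
    _ = ((15 + 2 * m) / ρ * C) ^ 2 := by field_simp

lemma abs_partialDeriv_castSucc_le {u : SpaceTime m → ℝ} (hu : ContDiff ℝ ∞ u) {z : SpaceTime m}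
    {ρ R C : ℝ} (hρ : 0 < ρ) (hρ1 : ρ ≤ 1)
    (hheat : ∀ w ∈ ball z R, heatOperator u w = 0) (hC : ∀ w ∈ closedBall z R, |u w| ≤ C)
    (j : Fin m) : ∀ w ∈ closedBall z (R - ρ),
      |partialDeriv j.castSucc u w| ≤ (15 + 2 * m) / ρ * C := by
  intro w hw
  have hdist : dist w z ≤ R - ρ := hw
  exact abs_partialDeriv_le_of_heat hu hρ hρ1
    (fun y hy => hheat y (ball_subset_ball' (by linarith) hy))
    (fun y hy => hC y (closedBall_subset_closedBall' (by linarith) hy)) j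

/-- Bound for all first derivatives. The time derivative is the spatial Laplacian, so that it is
reached by two applications of the spatial gradient estimate. -/
lemma abs_partialDeriv_le (hm : 1 ≤ m) {u : SpaceTime m → ℝ} (hu : ContDiff ℝ ∞ u)
    {z : SpaceTime m} {ρ R C : ℝ} (hρ : 0 < ρ) (hρ1 : ρ ≤ 1) (hR : 2 * ρ ≤ R)
    (hheat : ∀ w ∈ ball z R, heatOperator u w = 0) (hC : ∀ w ∈ closedBall z R, |u w| ≤ C)
    (j : Fin (m + 1)) : ∀ w ∈ closedBall z (R - 2 * ρ),
      |partialDeriv j u w| ≤ m * ((15 + 2 * m) / ρ) ^ 2 * C := by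
  intro w hw
  have hR0 : 0 ≤ R := by linarith
  have hC0 : 0 ≤ C := (abs_nonneg _).trans (hC z (mem_closedBall_self hR0))
  have hm' : (1 : ℝ) ≤ m := by exact_mod_cast hm
  set k : ℝ := (15 + 2 * m) / ρ with hk
  have hk1 : 1 ≤ k := by
    rw [hk, one_le_div hρ]; linarith
  have hdist : dist w z ≤ R - 2 * ρ := hw
  have hfirst := abs_partialDeriv_castSucc_le hu hρ hρ1 hheat hC
  induction j using Fin.lastCases with
  | cast j =>
    calc |partialDeriv j.castSucc u w| ≤ k * C :=
          hfirst j w (mem_closedBall.2 (by linarith))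
      _ = 1 * (k * 1) * C := by ring
      _ ≤ m * (k * k) * C := by gcongr
      _ = _ := by ring
  | last =>
    have hw' : w ∈ ball z R := mem_ball.2 (by linarith)
    have h := hheat w hw'
    rw [heatOperator, sub_eq_zero] at h
    rw [← h]
    calc |∑ i : Fin m, partialDeriv i.castSucc (partialDeriv i.castSucc u) w|
        ≤ ∑ i : Fin m, |partialDeriv i.castSucc (partialDeriv i.castSucc u) w| :=
          Finset.abs_sum_le_sum_abs _ _
      _ ≤ ∑ _i : Fin m, k * (k * C) := Finset.sum_le_sum fun i _ =>
          abs_partialDeriv_castSucc_le (contDiff_partialDeriv hu (by simp) _) hρ hρ1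
            (R := R - ρ)
            (fun y hy => heatOperator_partialDeriv_eq_zero hu isOpen_ball hheat _ y
              (ball_subset_ball (by linarith) hy))
            (hfirst i) i w (mem_closedBall.2 (by linarith))
      _ = m * k ^ 2 * C := by simp; ring

/-! ### Mollification of classical solutions -/

section Mollification

open MeasureTheory ContinuousLinearMap

open scoped Convolution

lemma partialDeriv_convolution {ψ g : SpaceTime m → ℝ} (hψ : LocallyIntegrable ψ)
    (hg : ContDiff ℝ 1 g) (hgs : HasCompactSupport g) (j : Fin (m + 1)) :
    partialDeriv j (ψ ⋆[lsmul ℝ ℝ] g) = ψ ⋆[lsmul ℝ ℝ] partialDeriv j g := by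
  funext z
  rw [partialDeriv, (hgs.hasFDerivAt_convolution_right (lsmul ℝ ℝ) hψ hg z).fderiv,
    convolution_precompR_apply _ hψ (hgs.fderiv ℝ) (hg.continuous_fderiv one_ne_zero)]
  rfl

lemma hasCompactSupport_partialDeriv {g : SpaceTime m → ℝ} (hgs : HasCompactSupport g)
    (j : Fin (m + 1)) : HasCompactSupport (partialDeriv j g) :=
  (hgs.fderiv_apply ℝ (EuclideanSpace.single j 1))

lemma heatOperator_convolution {ψ g : SpaceTime m → ℝ} (hψ : LocallyIntegrable ψ)
    (hg : ContDiff ℝ 2 g) (hgs : HasCompactSupport g) :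
    heatOperator (ψ ⋆[lsmul ℝ ℝ] g) = ψ ⋆[lsmul ℝ ℝ] heatOperator g := by
  funext z
  have h1 : ∀ i, ContDiff ℝ 1 (partialDeriv i g) := fun i =>
    contDiff_partialDeriv hg (by norm_num) i
  have h0 : ∀ i k, Continuous (partialDeriv i (partialDeriv k g)) := fun i k =>
    (contDiff_partialDeriv (k := 0) (h1 k) (by norm_num) i).continuous
  have hs : ∀ i, HasCompactSupport (partialDeriv i g) := hasCompactSupport_partialDeriv hgs
  have hi : ∀ i k, Integrable fun t =>
      lsmul ℝ ℝ (ψ t) (partialDeriv i (partialDeriv k g) (z - t)) := fun i k =>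
    (hasCompactSupport_partialDeriv (hs k) i).convolutionExists_right (lsmul ℝ ℝ) hψ (h0 i k) z
  have hl : Integrable fun t => lsmul ℝ ℝ (ψ t) (partialDeriv (Fin.last m) g (z - t)) :=
    (hs _).convolutionExists_right (lsmul ℝ ℝ) hψ (h1 _).continuous z
  have hd : ∀ i, partialDeriv i (ψ ⋆[lsmul ℝ ℝ] g) = ψ ⋆[lsmul ℝ ℝ] partialDeriv i g :=
    partialDeriv_convolution hψ (hg.of_le (by norm_num)) hgs
  simp only [heatOperator, hd, partialDeriv_convolution hψ (h1 _) (hs _)]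
  simp only [convolution]
  rw [← integral_finsetSum _ fun i _ => hi _ _,
    ← integral_sub (integrable_finsetSum _ fun i _ => hi _ _) hl]
  simp only [heatOperator, map_sub, map_sum]

/-- A classical solution on a neighbourhood of a closed ball is approximated, together with its
derivatives of order at most two at a point, by globally smooth functions which near that point
solve the heat equation with the same bound. -/
lemma exists_smooth_approximation {Ω : Set (SpaceTime m)} {u : SpaceTime m → ℝ} {c z : SpaceTime m}
    {r R C : ℝ} (hΩ : IsOpen Ω) (hu : SolvesHeatOn u Ω) (hr : 0 < r) (hR : 0 < R)
    (hsub : closedBall c r ⊆ Ω) (hC : ∀ w ∈ ball c r, |u w| ≤ C) (hz : dist z c + R < r) :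
    ∃ U : ℕ → SpaceTime m → ℝ,
      (∀ n, ContDiff ℝ ∞ (U n)) ∧
      (∀ᶠ n in atTop, (∀ w ∈ ball z R, heatOperator (U n) w = 0) ∧
        ∀ w ∈ closedBall z R, |U n w| ≤ C) ∧
      (∀ j, Tendsto (fun n => partialDeriv j (U n) z) atTop (𝓝 (partialDeriv j u z))) ∧
      ∀ i j, Tendsto (fun n => partialDeriv i (partialDeriv j (U n)) z) atTop
        (𝓝 (partialDeriv i (partialDeriv j u) z)) := by
  have hC0 : 0 ≤ C := (abs_nonneg _).trans (hC c (mem_ball_self hr))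
  -- An intermediate radius `s`, on which the localized function coincides with `u`.
  obtain ⟨s, hs1, hs2⟩ := exists_between hz
  have hs0 : 0 < s := by linarith [dist_nonneg (x := z) (y := c)]
  let χ : ContDiffBump c := ⟨s, r, hs0, hs2⟩
  set v : SpaceTime m → ℝ := fun w => χ w * u w with hv
  have hv2 : ContDiff ℝ 2 v := by
    refine contDiff_iff_contDiffAt.2 fun w => ?_
    by_cases hw : w ∈ closedBall c r
    · exact χ.contDiffAt.mul (hu.contDiffOn.contDiffAt (hΩ.mem_nhds (hsub hw)))
    · have : v =ᶠ[𝓝 w] fun _ => 0 := by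
        filter_upwards [isClosed_closedBall.isOpen_compl.mem_nhds hw] with y hy
        have : χ y = 0 := χ.zero_of_le_dist (le_of_not_ge hy)
        simp [hv, this]
      exact contDiffAt_const.congr_of_eventuallyEq this
  have hvs : HasCompactSupport v := χ.hasCompactSupport.mul_right
  have hvu : EqOn v u (ball c s) := fun w hw => by
    simp [hv, χ.one_of_mem_closedBall (ball_subset_closedBall hw)]
  have hvu' : ∀ w ∈ ball c s, v =ᶠ[𝓝 w] u := fun w hw =>
    hvu.eventuallyEq_of_mem (isOpen_ball.mem_nhds hw)
  have hvheat : ∀ w ∈ ball c s, heatOperator v w = 0 := fun w hw => by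
    rw [← hu.heat_eq w (hsub (ball_subset_closedBall (ball_subset_ball hs2.le hw)))]
    simp only [heatOperator, partialDeriv_congr _ (hvu' w hw),
      partialDeriv_congr _ (partialDeriv_congr_eventually _ (hvu' w hw))]
  have hvC : ∀ w ∈ ball c s, |v w| ≤ C := fun w hw => by
    rw [hvu hw]; exact hC w (ball_subset_ball hs2.le hw)
  let φ : ℕ → ContDiffBump (0 : SpaceTime m) := fun n =>
    ⟨1 / ((n : ℝ) + 1) / 2, 1 / ((n : ℝ) + 1), by positivity, half_lt_self (by positivity)⟩
  have hφ : Tendsto (fun n => (φ n).rOut) atTop (𝓝 0) := tendsto_one_div_add_atTop_nhds_zero_nat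
  have hψ : ∀ n, LocallyIntegrable ((φ n).normed volume) := fun n =>
    ((φ n).continuous_normed (μ := volume)).locallyIntegrable
  have hd : ∀ n i, partialDeriv i ((φ n).normed volume ⋆[lsmul ℝ ℝ] v) =
      (φ n).normed volume ⋆[lsmul ℝ ℝ] partialDeriv i v := fun n i =>
    partialDeriv_convolution (hψ n) (hv2.of_le (by norm_num)) hvs i
  have hv1 : ∀ i, ContDiff ℝ 1 (partialDeriv i v) := fun i =>
    contDiff_partialDeriv hv2 (by norm_num) i
  have hzs : z ∈ ball c s := mem_ball.2 (by linarith)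
  refine ⟨fun n => (φ n).normed volume ⋆[lsmul ℝ ℝ] v, fun n => ?_, ?_, fun j => ?_, fun i j => ?_⟩
  · exact (φ n).hasCompactSupport_normed.contDiff_convolution_left _ (φ n).contDiff_normed
      hv2.continuous.locallyIntegrable
  · have hsmall : ∀ᶠ n in atTop, (φ n).rOut < s - (dist z c + R) :=
      hφ.eventually_lt_const (by linarith)
    filter_upwards [hsmall] with n hn
    have hin : ∀ w ∈ closedBall z R, ball w (φ n).rOut ⊆ ball c s := fun w hw =>
      ball_subset_ball' (by linarith [dist_triangle w z c, mem_closedBall.1 hw])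
    refine ⟨fun w hw => ?_, fun w hw => ?_⟩
    · have hw' := ball_subset_closedBall hw
      have h0 := hvheat w (hin w hw' (mem_ball_self (φ n).rOut_pos))
      rw [heatOperator_convolution (hψ n) hv2 hvs, (φ n).normed_convolution_eq_right, h0]
      intro y hy
      rw [h0, hvheat y (hin w hw' hy)]
    · have := dist_convolution_le (μ := volume) (x₀ := w) (z₀ := (0 : ℝ)) hC0
        (φ n).support_normed_eq.subset
        (φ n).nonneg_normed ((φ n).integral_normed (μ := volume)) hv2.continuous.aestronglyMeasurable
        (fun y hy => by simpa using hvC y (hin w hw hy))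
      simpa using this
  · simp only [hd]
    rw [← partialDeriv_congr j (hvu' z hzs)]
    exact ContDiffBump.convolution_tendsto_right_of_continuous hφ (hv1 j).continuous z
  · simp only [hd, partialDeriv_convolution (hψ _) (hv1 _) (hasCompactSupport_partialDeriv hvs _)]
    rw [← partialDeriv_congr i (partialDeriv_congr_eventually j (hvu' z hzs))]
    exact ContDiffBump.convolution_tendsto_right_of_continuous hφ
      (contDiff_partialDeriv (k := 0) (hv1 j) (by norm_num) i).continuous z

end Mollification

/-! ### Existence of the interior estimate constant -/

lemma exists_isInteriorEstimateConstant (hm : 1 ≤ m) : ∃ a : ℝ, IsInteriorEstimateConstant m a := by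
  have hm' : (1 : ℝ) ≤ m := by exact_mod_cast hm
  set b : ℝ := m * (8 * (15 + 2 * m)) ^ 2 with hb
  have hb1 : 1 ≤ b := by rw [hb]; nlinarith
  -- With `ρ = r / 8`, two applications of the estimate of all first derivatives stay inside a
  -- ball of radius `r / 2`.
  have key : ∀ (Ω : Set (SpaceTime m)) (u : SpaceTime m → ℝ) (c : SpaceTime m) (r C : ℝ),
      IsOpen Ω → SolvesHeatOn u Ω → 0 < r → r < 1 → closedBall c r ⊆ Ω →
      (∀ z ∈ ball c r, |u z| ≤ C) → ∀ z ∈ ball c (r ^ 2 / 4),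
      (∀ j, |partialDeriv j u z| ≤ b / r ^ 2 * C) ∧
        ∀ i j, |partialDeriv i (partialDeriv j u) z| ≤ (b / r ^ 2) * (b / r ^ 2 * C) := by
    intro Ω u c r C hΩ hu hr hr1 hsub hC z hz
    have hzc : dist z c < r ^ 2 / 4 := hz
    obtain ⟨U, hU, hev, h1, h2⟩ := exists_smooth_approximation hΩ hu hr (half_pos hr) hsub hC
      (z := z) (by nlinarith)
    have hbr : m * ((15 + 2 * m) / (r / 8)) ^ 2 = b / r ^ 2 := by rw [hb]; field_simp
    have hbound : ∀ᶠ n in atTop, ∀ j, ∀ w ∈ closedBall z (r / 2 - 2 * (r / 8)),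
        |partialDeriv j (U n) w| ≤ b / r ^ 2 * C := by
      filter_upwards [hev] with n hn j w hw
      rw [← hbr]
      exact abs_partialDeriv_le hm (hU n) (by positivity) (by linarith) (by linarith)
        hn.1 hn.2 j w hw
    refine ⟨fun j => ?_, fun i j => ?_⟩
    · refine le_of_tendsto (h1 j).abs ?_
      filter_upwards [hbound] with n hn
      exact hn j z (mem_closedBall_self (by linarith))
    · refine le_of_tendsto (h2 i j).abs ?_
      filter_upwards [hbound, hev] with n hn hn'
      rw [← hbr]
      refine abs_partialDeriv_le hm (contDiff_partialDeriv (hU n) (by simp) j) (z := z)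
        (R := r / 2 - 2 * (r / 8)) (by positivity) (by linarith) (by linarith) ?_ ?_ i z
        (mem_closedBall_self (by linarith))
      · exact fun w hw => heatOperator_partialDeriv_eq_zero (hU n) isOpen_ball hn'.1 j w
          (ball_subset_ball (by linarith) hw)
      · rw [hbr]; exact hn j
  refine ⟨b ^ 2, one_le_pow₀ hb1, ?_, ?_⟩
  · intro Ω u c r C hΩ hu hr hr1 hsub hC z hz j
    have hC0 : 0 ≤ C := (abs_nonneg _).trans (hC c (mem_ball_self hr))
    refine ((key Ω u c r C hΩ hu hr hr1 hsub hC z hz).1 j).trans ?_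
    gcongr
    nlinarith
  · intro Ω u c r C hΩ hu hr hr1 hsub hC z hz i j
    refine ((key Ω u c r C hΩ hu hr hr1 hsub hC z hz).2 i j).trans_eq ?_
    field_simp

/-! ### A quantitative inverse function theorem -/

/-- If `f'` stays within `σ / 2` of a linear map `A` that expands lengths by at least `σ`, then
`f` is injective near `z` and its image contains an explicit ball. -/
lemma exists_bijOn_ball_of_fderiv_near {E : Type*} [NormedAddCommGroup E] [NormedSpace ℝ E]
    [FiniteDimensional ℝ E] {f : E → E} {A : E →L[ℝ] E} {z : E} {σ δ : ℝ} (hσ : 0 < σ)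
    (hδ : 0 < δ) (hA : ∀ v, σ * ‖v‖ ≤ ‖A v‖) (hf : ∀ w ∈ ball z δ, DifferentiableAt ℝ f w)
    (hf' : ∀ w ∈ ball z δ, ‖fderiv ℝ f w - A‖ ≤ σ / 2) :
    ∃ Ω ⊆ ball z δ, IsOpen Ω ∧ IsConnected Ω ∧ BijOn f Ω (ball (f z) (σ * δ / 4)) := by
  have : CompleteSpace E := FiniteDimensional.complete ℝ E
  rcases subsingleton_or_nontrivial E with hE | hE
  · refine ⟨ball z δ, Subset.rfl, isOpen_ball, isConnected_ball hδ, ?_, ?_, ?_⟩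
    · intro x _
      rw [Subsingleton.elim (f x) (f z)]
      exact mem_ball_self (by positivity)
    · exact fun x _ y _ _ => Subsingleton.elim _ _
    · exact fun y _ => ⟨z, mem_ball_self hδ, Subsingleton.elim _ _⟩
  have hinj : Function.Injective A := by
    refine (injective_iff_map_eq_zero A).2 fun v hv => ?_
    have := hA v
    rw [hv, norm_zero] at this
    exact norm_le_zero_iff.1 (by nlinarith [norm_nonneg v])
  let e : E ≃L[ℝ] E :=
    (LinearEquiv.ofInjectiveEndo (A : E →ₗ[ℝ] E) hinj).toContinuousLinearEquiv
  have heA : (e : E →L[ℝ] E) = A := by ext v; rfl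
  have hsymm : ‖(e.symm : E →L[ℝ] E)‖ ≤ σ⁻¹ := by
    refine ContinuousLinearMap.opNorm_le_bound _ (by positivity) fun v => ?_
    have h := hA (e.symm v)
    have h2 : A (e.symm v) = v := e.apply_symm_apply v
    rw [h2] at h
    rw [inv_mul_eq_div, le_div_iff₀ hσ]
    simpa [mul_comm] using h
  have hsymm0 : 0 < ‖(e.symm : E →L[ℝ] E)‖ := e.norm_symm_pos
  have hN : σ ≤ ((‖(e.symm : E →L[ℝ] E)‖₊⁻¹ : NNReal) : ℝ) := by
    rw [NNReal.coe_inv, coe_nnnorm]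
    exact (le_inv_comm₀ hσ hsymm0).2 hsymm
  let k : NNReal := ⟨σ / 2, by positivity⟩
  have happ : ApproximatesLinearOn f (e : E →L[ℝ] E) (ball z δ) k := by
    intro x hx y hy
    rw [heA]
    exact (convex_ball z δ).norm_image_sub_le_of_norm_fderiv_le' hf hf' hy hx
  have hk : k < ‖(e.symm : E →L[ℝ] E)‖₊⁻¹ := by
    rw [← NNReal.coe_lt_coe]
    exact (half_lt_self hσ).trans_le hN
  set Φ := happ.toOpenPartialHomeomorph f (ball z δ) (Or.inr hk) isOpen_ball with hΦ
  have htarget : ball (f z) (σ * δ / 4) ⊆ Φ.target := by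
    refine Subset.trans ?_ (happ.closedBall_subset_target (Or.inr hk) isOpen_ball (b := z)
      (ε := δ / 2) (by positivity) (closedBall_subset_ball (half_lt_self hδ)))
    refine (ball_subset_ball ?_).trans ball_subset_closedBall
    have hkv : (k : ℝ) = σ / 2 := rfl
    rw [hkv]
    nlinarith
  refine ⟨Φ.symm '' ball (f z) (σ * δ / 4), ?_, ?_, ?_, ?_⟩
  · rintro _ ⟨y, hy, rfl⟩
    exact Φ.map_target (htarget hy)
  · exact Φ.symm.isOpen_image_of_subset_source isOpen_ball htarget
  · exact (isConnected_ball (by positivity)).image _ (Φ.continuousOn_symm.mono htarget)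
  · have h1 : ∀ y ∈ ball (f z) (σ * δ / 4), f (Φ.symm y) = y := fun y hy =>
      Φ.right_inv (htarget hy)
    refine ⟨?_, ?_, fun y hy => ⟨Φ.symm y, mem_image_of_mem _ hy, h1 y hy⟩⟩
    · rintro _ ⟨y, hy, rfl⟩
      rwa [h1 y hy]
    · rintro _ ⟨y, hy, rfl⟩ _ ⟨y', hy', rfl⟩ h
      rw [h1 y hy, h1 y' hy'] at h
      rw [h]

/-! ### Linear algebra of the Jacobian -/

/-- Hadamard's inequality, in an orthonormal basis that begins with the direction of `v`. -/
lemma abs_det_mul_norm_le (A : SpaceTime m →L[ℝ] SpaceTime m) (v : SpaceTime m) :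
    |LinearMap.det (A : SpaceTime m →ₗ[ℝ] SpaceTime m)| * ‖v‖ ≤ ‖A v‖ * ‖A‖ ^ m := by
  rcases eq_or_ne v 0 with rfl | hv
  · simp
  have : Fact (Module.finrank ℝ (SpaceTime m) = m + 1) := ⟨by simp⟩
  have hv0 : 0 < ‖v‖ := norm_pos_iff.2 hv
  have hunit : ‖(‖v‖⁻¹ • v)‖ = 1 := by
    rw [norm_smul, norm_inv, norm_norm, inv_mul_cancel₀ hv0.ne']
  have horth : Orthonormal ℝ (({0} : Set (Fin (m + 1))).domRestrict fun _ => ‖v‖⁻¹ • v) := by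
    refine ⟨fun _ => hunit, fun i j hij => (hij (Subsingleton.elim i j)).elim⟩
  obtain ⟨b, hb⟩ := horth.exists_orthonormalBasis_extension_of_card_eq (by simp)
  have hb0 : b 0 = ‖v‖⁻¹ • v := hb 0 rfl
  have hdet : |LinearMap.det (A : SpaceTime m →ₗ[ℝ] SpaceTime m)| ≤ ∏ i, ‖A (b i)‖ := by
    have h := (b.toBasis.orientation).abs_volumeForm_apply_le fun i => A (b i)
    rw [b.toBasis.orientation.volumeForm_robust b rfl] at h
    have h2 : (fun i => A (b i)) = (A : SpaceTime m →ₗ[ℝ] SpaceTime m) ∘ b.toBasis := by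
      funext i; simp
    rwa [h2, Module.Basis.det_comp, Module.Basis.det_self, mul_one] at h
  have hprod : ∏ i : Fin m, ‖A (b i.succ)‖ ≤ ‖A‖ ^ m := by
    refine (Finset.prod_le_prod (fun i _ => norm_nonneg _) fun i _ =>
      (A.le_opNorm (b i.succ)).trans_eq ?_).trans_eq (b := ∏ _i : Fin m, ‖A‖) (by simp)
    rw [b.norm_eq_one, mul_one]
  rw [Fin.prod_univ_succ, hb0, map_smul, norm_smul, norm_inv, norm_norm] at hdet
  calc _ ≤ (‖v‖⁻¹ * ‖A v‖ * ‖A‖ ^ m) * ‖v‖ := by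
        gcongr
        exact hdet.trans (by gcongr)
    _ = ‖A v‖ * ‖A‖ ^ m := by field_simp

lemma abs_det_le_opNorm_pow (A : SpaceTime m →L[ℝ] SpaceTime m) :
    |LinearMap.det (A : SpaceTime m →ₗ[ℝ] SpaceTime m)| ≤ ‖A‖ ^ (m + 1) := by
  have h := abs_det_mul_norm_le A (EuclideanSpace.single 0 1)
  have h1 := A.le_opNorm (EuclideanSpace.single 0 1)
  simp only [PiLp.norm_single, norm_one, mul_one] at h h1
  refine h.trans ?_
  rw [pow_succ']
  gcongr

lemma opNorm_le_sqrt_sum_sq (A : SpaceTime m →L[ℝ] SpaceTime m) :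
    ‖A‖ ≤ √(∑ i, ∑ j, |A (EuclideanSpace.single j 1) i| ^ 2) := by
  refine ContinuousLinearMap.opNorm_le_bound _ (Real.sqrt_nonneg _) fun v => ?_
  have hcoord : ∀ i, A v i = ∑ j, A (EuclideanSpace.single j 1) i * v j := by
    intro i
    have hv : v = ∑ j, v j • EuclideanSpace.single j (1 : ℝ) := by
      have := (EuclideanSpace.basisFun (Fin (m + 1)) ℝ).sum_repr v
      simpa using this.symm
    conv_lhs => rw [hv]
    simp [mul_comm]
  rw [EuclideanSpace.norm_eq, EuclideanSpace.norm_eq v, ← Real.sqrt_mul (by positivity)]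
  refine Real.sqrt_le_sqrt ?_
  rw [Finset.sum_mul]
  refine Finset.sum_le_sum fun i _ => ?_
  simp only [Real.norm_eq_abs, sq_abs, hcoord i]
  exact Finset.sum_mul_sq_le_sq_mul_sq _ _ _

lemma opNorm_le_sum_abs (φ : SpaceTime m →L[ℝ] ℝ) :
    ‖φ‖ ≤ ∑ j, |φ (EuclideanSpace.single j 1)| := by
  refine ContinuousLinearMap.opNorm_le_bound _ (Finset.sum_nonneg fun _ _ => abs_nonneg _)
    fun v => ?_
  have hv : v = ∑ j, v j • EuclideanSpace.single j (1 : ℝ) := by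
    have := (EuclideanSpace.basisFun (Fin (m + 1)) ℝ).sum_repr v
    simpa using this.symm
  conv_lhs => rw [hv, map_sum]
  refine (norm_sum_le _ _).trans ?_
  rw [Finset.sum_mul]
  refine Finset.sum_le_sum fun j _ => ?_
  rw [map_smul, norm_smul, mul_comm, Real.norm_eq_abs]
  gcongr
  exact PiLp.norm_apply_le v j

lemma fderiv_single_apply {F : SpaceTime m → SpaceTime m} {z : SpaceTime m}
    (hF : DifferentiableAt ℝ F z) (i j : Fin (m + 1)) :
    fderiv ℝ F z (EuclideanSpace.single j 1) i = jacobian F z i j := by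
  have h : HasFDerivAt (fun w => F w i)
      ((EuclideanSpace.proj i : SpaceTime m →L[ℝ] ℝ).comp (fderiv ℝ F z)) z :=
    (EuclideanSpace.proj i : SpaceTime m →L[ℝ] ℝ).hasFDerivAt.comp z hF.hasFDerivAt
  simp [jacobian, partialDeriv, h.fderiv]

lemma norm_fderiv_le_frobeniusNorm {F : SpaceTime m → SpaceTime m} {z : SpaceTime m}
    (hF : DifferentiableAt ℝ F z) : ‖fderiv ℝ F z‖ ≤ frobeniusNorm (jacobian F z) := by
  have h := opNorm_le_sqrt_sum_sq (fderiv ℝ F z)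
  simp only [fderiv_single_apply hF] at h
  exact h

lemma det_fderiv {F : SpaceTime m → SpaceTime m} {z : SpaceTime m} (hF : DifferentiableAt ℝ F z) :
    LinearMap.det (fderiv ℝ F z : SpaceTime m →ₗ[ℝ] SpaceTime m) = (jacobian F z).det := by
  rw [← LinearMap.det_toMatrix (EuclideanSpace.basisFun (Fin (m + 1)) ℝ).toBasis]
  congr 1
  ext i j
  simp [LinearMap.toMatrix_apply, fderiv_single_apply hF]

/-! ### Bochner–Takahashi mappings -/

/-- The geometric mean `|det F'(z)|^(1/(m+1))` of the singular values of `F'(z)`. -/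
noncomputable def jacobianScale (F : SpaceTime m → SpaceTime m) (z : SpaceTime m) : ℝ :=
  |(jacobian F z).det| ^ (1 / ((m : ℝ) + 1))

lemma jacobianScale_nonneg (F : SpaceTime m → SpaceTime m) (z : SpaceTime m) :
    0 ≤ jacobianScale F z :=
  Real.rpow_nonneg (abs_nonneg _) _

lemma jacobianScale_pow (F : SpaceTime m → SpaceTime m) (z : SpaceTime m) :
    jacobianScale F z ^ (m + 1) = |(jacobian F z).det| := by
  rw [jacobianScale, ← Real.rpow_natCast, ← Real.rpow_mul (abs_nonneg _)]
  push_cast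
  rw [one_div_mul_cancel (by positivity), Real.rpow_one]

namespace IsHeatBochnerTakahashi

variable {K : ℝ} {F : SpaceTime m → SpaceTime m}

lemma contDiffOn (hF : IsHeatBochnerTakahashi K F) : ContDiffOn ℝ 2 F (ball 0 1) :=
  contDiffOn_euclidean.2 fun i => (hF.solvesHeat i).contDiffOn

lemma differentiableAt (hF : IsHeatBochnerTakahashi K F) {z : SpaceTime m} (hz : z ∈ ball 0 1) :
    DifferentiableAt ℝ F z :=
  (hF.contDiffOn.contDiffAt (isOpen_ball.mem_nhds hz)).differentiableAt (by norm_num)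

lemma differentiableAt_partialDeriv (hF : IsHeatBochnerTakahashi K F) {z : SpaceTime m}
    (hz : z ∈ ball 0 1) (i j : Fin (m + 1)) :
    DifferentiableAt ℝ (partialDeriv j fun w => F w i) z :=
  (contDiffAt_partialDeriv (k := 1) ((hF.solvesHeat i).contDiffOn.contDiffAt
    (isOpen_ball.mem_nhds hz)) (by norm_num) j).differentiableAt (by norm_num)

lemma continuousOn_jacobian (hF : IsHeatBochnerTakahashi K F) :
    ContinuousOn (jacobian F) (ball 0 1) :=
  continuousOn_pi.2 fun i => continuousOn_pi.2 fun j => fun _ hz =>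
    (hF.differentiableAt_partialDeriv hz i j).continuousAt.continuousWithinAt

lemma continuousOn_jacobianScale (hF : IsHeatBochnerTakahashi K F) :
    ContinuousOn (jacobianScale F) (ball 0 1) := by
  have h : ContinuousOn (fun z => (jacobian F z).det) (ball 0 1) :=
    (Continuous.matrix_det continuous_id).comp_continuousOn hF.continuousOn_jacobian
  exact h.abs.rpow_const fun _ _ => Or.inr (by positivity)

lemma continuousOn_frobeniusNorm (hF : IsHeatBochnerTakahashi K F) :
    ContinuousOn (fun z => frobeniusNorm (jacobian F z)) (ball 0 1) := by
  have h : Continuous (frobeniusNorm (m := m)) := by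
    unfold frobeniusNorm
    fun_prop
  exact h.comp_continuousOn hF.continuousOn_jacobian

/-- A bound for `|det F'|^(1/(m+1))` on a ball about the origin gives a bound for `F'` there. -/
lemma frobeniusNorm_le (hF : IsHeatBochnerTakahashi K F) (hK : 0 ≤ K) {r M : ℝ} (hr0 : 0 ≤ r)
    (hr1 : r < 1) (hM : ∀ w ∈ closedBall 0 r, jacobianScale F w ≤ M) :
    ∀ z ∈ closedBall 0 r, frobeniusNorm (jacobian F z) ≤ K * M := by
  intro z hz
  have hbdd : BddAbove ((fun z => frobeniusNorm (jacobian F z)) '' closedBall 0 r) :=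
    (isCompact_closedBall 0 r).bddAbove_image
      (hF.continuousOn_frobeniusNorm.mono (closedBall_subset_ball hr1))
  refine (le_csSup hbdd (mem_image_of_mem _ hz)).trans ((hF.takahashi r hr0 hr1).trans ?_)
  refine mul_le_mul_of_nonneg_left (csSup_le ⟨_, mem_image_of_mem _ hz⟩ ?_) hK
  rintro _ ⟨w, hw, rfl⟩
  exact hM w hw

lemma one_le (hF : IsHeatBochnerTakahashi K F) (h0 : |(jacobian F 0).det| = 1) : 1 ≤ K := by
  have h := hF.takahashi 0 le_rfl one_pos
  simp only [closedBall_zero, image_singleton, csSup_singleton, h0, Real.one_rpow, mul_one] at h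
  have hd := hF.differentiableAt (mem_ball_self one_pos)
  have hle := abs_det_le_opNorm_pow (fderiv ℝ F 0)
  rw [det_fderiv hd, h0] at hle
  have h1 : 1 ≤ ‖fderiv ℝ F 0‖ := by
    by_contra! hlt
    exact (pow_lt_one₀ (norm_nonneg _) hlt (Nat.succ_ne_zero m)).not_ge hle
  exact h1.trans ((norm_fderiv_le_frobeniusNorm hd).trans h)

/-- Landau's rescaling: there is a ball `B_s(z₀)` on which `|det F'|^(1/(m+1))` is at most `8` times
its value at `z₀`, while `s³` times this value is bounded from below. The exponent `3` matches the
`s⁻³` in the Lipschitz constant of `F'` that the second order interior estimates provide. -/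
lemma exists_rescaling_point (hF : IsHeatBochnerTakahashi K F) (h0 : |(jacobian F 0).det| = 1) :
    ∃ (z₀ : SpaceTime m) (s : ℝ), 0 < s ∧ ‖z₀‖ + s < 1 / 2 ∧
      1 / 64 ≤ s ^ 3 * jacobianScale F z₀ ∧
      (∀ z ∈ closedBall 0 ‖z₀‖, jacobianScale F z ≤ jacobianScale F z₀) ∧
      ∀ z ∈ closedBall 0 (‖z₀‖ + s), jacobianScale F z ≤ 8 * jacobianScale F z₀ := by
  have hsub : closedBall (0 : SpaceTime m) (1 / 2) ⊆ ball 0 1 :=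
    closedBall_subset_ball (by norm_num)
  have hcont : ContinuousOn (fun z : SpaceTime m => (1 / 2 - ‖z‖) ^ 3 * jacobianScale F z)
      (closedBall 0 (1 / 2)) :=
    ((continuous_const.sub continuous_norm).pow 3).continuousOn.mul
      (hF.continuousOn_jacobianScale.mono hsub)
  obtain ⟨z₀, hz₀, hmax⟩ := (isCompact_closedBall (0 : SpaceTime m) (1 / 2)).exists_isMaxOn
    ⟨0, mem_closedBall_self (by norm_num)⟩ hcont
  have hmax' : ∀ z ∈ closedBall (0 : SpaceTime m) (1 / 2),
      (1 / 2 - ‖z‖) ^ 3 * jacobianScale F z ≤ (1 / 2 - ‖z₀‖) ^ 3 * jacobianScale F z₀ :=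
    fun z hz => hmax hz
  have hstart := hmax' 0 (mem_closedBall_self (by norm_num))
  simp only [jacobianScale, h0, Real.one_rpow, norm_zero] at hstart
  rw [← jacobianScale] at hstart
  rw [mem_closedBall_zero_iff] at hz₀
  have hpos : 0 < 1 / 2 - ‖z₀‖ := by
    rcases hz₀.eq_or_lt with h | h
    · rw [h] at hstart
      norm_num at hstart
    · linarith
  have hcmp : ∀ (z : SpaceTime m) (t : ℝ), 0 < t → t ≤ 1 / 2 - ‖z‖ →
      jacobianScale F z ≤ ((1 / 2 - ‖z₀‖) / t) ^ 3 * jacobianScale F z₀ := by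
    intro z t ht htz
    have h1 := hmax' z (mem_closedBall_zero_iff.2 (by linarith))
    have h2 : t ^ 3 * jacobianScale F z ≤ (1 / 2 - ‖z‖) ^ 3 * jacobianScale F z :=
      mul_le_mul_of_nonneg_right (pow_le_pow_left₀ ht.le htz 3) (jacobianScale_nonneg F z)
    rw [div_pow, div_mul_eq_mul_div, le_div_iff₀ (by positivity)]
    linarith
  refine ⟨z₀, (1 / 2 - ‖z₀‖) / 2, by positivity, by linarith, by nlinarith, fun z hz => ?_,
    fun z hz => ?_⟩
  · rw [mem_closedBall_zero_iff] at hz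
    have := hcmp z (1 / 2 - ‖z₀‖) hpos (by linarith)
    rwa [div_self hpos.ne', one_pow, one_mul] at this
  · rw [mem_closedBall_zero_iff] at hz
    have := hcmp z ((1 / 2 - ‖z₀‖) / 2) (by positivity) (by linarith)
    have h2 : (1 / 2 - ‖z₀‖) / ((1 / 2 - ‖z₀‖) / 2) = 2 :=
      div_div_cancel₀ hpos.ne'
    rw [h2] at this
    linarith

/-- The interior estimates make `F'` Lipschitz on a ball where `F'` is bounded. -/
lemma norm_fderiv_sub_le (hF : IsHeatBochnerTakahashi K F) {a : ℝ}
    (ha : IsInteriorEstimateConstant m a) {z₀ : SpaceTime m} {s B : ℝ} (hs : 0 < s) (hs1 : s < 1)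
    (hsub : closedBall z₀ s ⊆ ball 0 1) (hB : ∀ z ∈ ball z₀ s, ‖fderiv ℝ F z‖ ≤ B) :
    ∀ z ∈ ball z₀ (s ^ 2 / 4),
      ‖fderiv ℝ F z - fderiv ℝ F z₀‖ ≤ (m + 1) ^ 2 * (a / s ^ 4 * (B * s)) * ‖z - z₀‖ := by
  have hB0 : 0 ≤ B := (norm_nonneg _).trans (hB z₀ (mem_ball_self hs))
  have ha0 : 0 ≤ a := zero_le_one.trans ha.one_le
  have hin : ball z₀ s ⊆ ball 0 1 := ball_subset_closedBall.trans hsub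
  have hsmall : ball z₀ (s ^ 2 / 4) ⊆ ball z₀ s := ball_subset_ball (by nlinarith)
  set H : ℝ := a / s ^ 4 * (B * s) with hH
  have hH0 : 0 ≤ H := by positivity
  have hsecond : ∀ i j k : Fin (m + 1), ∀ z ∈ ball z₀ (s ^ 2 / 4),
      |partialDeriv k (partialDeriv j fun w => F w i) z| ≤ H := by
    intro i j k z hz
    have hD : ∀ j, partialDeriv j (fun w => F w i - F z₀ i) = partialDeriv j fun w => F w i :=
      fun j => funext fun w => partialDeriv_sub_const j _ _ w
    have hsolves : SolvesHeatOn (fun w => F w i - F z₀ i) (ball 0 1) := by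
      refine ⟨(hF.solvesHeat i).contDiffOn.sub contDiffOn_const, fun w hw => ?_⟩
      rw [← (hF.solvesHeat i).heat_eq w hw]
      simp only [heatOperator, hD]
    have h := ha.second_order (ball 0 1) (fun w => F w i - F z₀ i) z₀ s (B * s) isOpen_ball
      hsolves hs hs1 hsub ?_ z hz k j
    · rwa [hD] at h
    · intro w hw
      have h1 := (convex_ball z₀ s).norm_image_sub_le_of_norm_fderiv_le (𝕜 := ℝ)
        (fun y hy => hF.differentiableAt (hin hy)) hB (mem_ball_self hs) hw
      calc |F w i - F z₀ i| = ‖(F w - F z₀) i‖ := by simp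
        _ ≤ ‖F w - F z₀‖ := PiLp.norm_apply_le _ i
        _ ≤ B * ‖w - z₀‖ := h1
        _ ≤ B * s := by
          gcongr
          exact (mem_ball_iff_norm.1 hw).le
  intro z hz
  have hentry : ∀ i j, |jacobian F z i j - jacobian F z₀ i j| ≤ (m + 1) * H * ‖z - z₀‖ := by
    intro i j
    refine (convex_ball z₀ (s ^ 2 / 4)).norm_image_sub_le_of_norm_fderiv_le (𝕜 := ℝ)
      (f := partialDeriv j fun w => F w i)
      (fun y hy => hF.differentiableAt_partialDeriv (hin (hsmall hy)) i j) (fun y hy => ?_)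
      (mem_ball_self (by positivity)) hz
    refine (opNorm_le_sum_abs _).trans ((Finset.sum_le_sum fun k _ =>
      hsecond i j k y hy).trans_eq ?_)
    simp
  have hdz := hF.differentiableAt (hin (hsmall hz))
  have hdz₀ := hF.differentiableAt (hin (mem_ball_self hs))
  refine (opNorm_le_sqrt_sum_sq _).trans (Real.sqrt_le_iff.2 ⟨by positivity, ?_⟩)
  calc ∑ i, ∑ j, |(fderiv ℝ F z - fderiv ℝ F z₀) (EuclideanSpace.single j 1) i| ^ 2
      ≤ ∑ _i : Fin (m + 1), ∑ _j : Fin (m + 1), ((m + 1) * H * ‖z - z₀‖) ^ 2 := by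
        refine Finset.sum_le_sum fun i _ => Finset.sum_le_sum fun j _ => ?_
        have : (fderiv ℝ F z - fderiv ℝ F z₀) (EuclideanSpace.single j 1) i =
            jacobian F z i j - jacobian F z₀ i j := by
          rw [← fderiv_single_apply hdz, ← fderiv_single_apply hdz₀]
          simp
        rw [this]
        exact pow_le_pow_left₀ (abs_nonneg _) (hentry i j) 2
    _ = ((m + 1) ^ 2 * H * ‖z - z₀‖) ^ 2 := by
        simp
        ring

/-- A Bochner–Takahashi mapping covers a schlicht disk whose radius is controlled by `a` and `K`. -/
lemma coversSchlichtDisk (hF : IsHeatBochnerTakahashi K F) {a : ℝ}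
    (ha : IsInteriorEstimateConstant m a) (h0 : |(jacobian F 0).det| = 1) :
    ∃ R, 1 / (4096 * ((m + 1) ^ 2 * (a * K ^ (2 * m + 1)))) ≤ R ∧ CoversSchlichtDisk F R := by
  have hK1 : 1 ≤ K := hF.one_le h0
  have hK0 : 0 < K := by linarith
  have ha1 := ha.one_le
  have ha0 : 0 < a := by linarith
  obtain ⟨z₀, s, hs, hzs, hlow, hM₀, hM⟩ := hF.exists_rescaling_point h0
  set M := jacobianScale F z₀ with hMdef
  have hMpos : 0 < M := by
    by_contra! h
    nlinarith [pow_pos hs 3]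
  have hs1 : s < 1 := by linarith [norm_nonneg z₀]
  have hz₀1 : ‖z₀‖ < 1 := by linarith
  have hsub : closedBall z₀ s ⊆ ball 0 1 := fun z hz => by
    have := norm_le_norm_add_norm_sub' z z₀
    rw [mem_closedBall_iff_norm] at hz
    exact mem_ball_zero_iff.2 (by linarith)
  have hB : ∀ z ∈ ball z₀ s, ‖fderiv ℝ F z‖ ≤ K * (8 * M) := fun z hz => by
    refine (norm_fderiv_le_frobeniusNorm (hF.differentiableAt
      (hsub (ball_subset_closedBall hz)))).trans ?_
    refine hF.frobeniusNorm_le hK0.le (by positivity) (by linarith) hM z ?_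
    have := norm_le_norm_add_norm_sub' z z₀
    rw [mem_ball_iff_norm] at hz
    exact mem_closedBall_zero_iff.2 (by linarith)
  have hd₀ : DifferentiableAt ℝ F z₀ := hF.differentiableAt (mem_ball_zero_iff.2 hz₀1)
  have hA : ‖fderiv ℝ F z₀‖ ≤ K * M :=
    (norm_fderiv_le_frobeniusNorm hd₀).trans (hF.frobeniusNorm_le hK0.le (norm_nonneg z₀) hz₀1
      hM₀ z₀ (mem_closedBall_zero_iff.2 le_rfl))
  set σ : ℝ := M / K ^ m with hσ
  have hexpand : ∀ v, σ * ‖v‖ ≤ ‖fderiv ℝ F z₀ v‖ := fun v => by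
    have h1 := abs_det_mul_norm_le (fderiv ℝ F z₀) v
    rw [det_fderiv hd₀, ← jacobianScale_pow, ← hMdef] at h1
    have h2 : M ^ (m + 1) * ‖v‖ ≤ ‖fderiv ℝ F z₀ v‖ * (K * M) ^ m := h1.trans (by gcongr)
    have h3 : M ^ m * (M * ‖v‖) ≤ M ^ m * (‖fderiv ℝ F z₀ v‖ * K ^ m) := by
      rw [mul_pow] at h2
      linear_combination h2
    rw [hσ, div_mul_eq_mul_div, div_le_iff₀ (by positivity)]
    exact le_of_mul_le_mul_left h3 (by positivity)
  -- The radius on which `F'` varies by at most `σ / 2`.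
  set δ : ℝ := s ^ 3 / (16 * ((m + 1) ^ 2 * (a * K ^ (m + 1)))) with hδ
  have hδpos : 0 < δ := by positivity
  have hδle : δ ≤ s ^ 2 / 4 := by
    have hden : (1 : ℝ) ≤ (m + 1) ^ 2 * (a * K ^ (m + 1)) :=
      one_le_mul_of_one_le_of_one_le (one_le_pow₀ (by linarith [Nat.cast_nonneg (α := ℝ) m]))
        (one_le_mul_of_one_le_of_one_le ha1 (one_le_pow₀ hK1))
    rw [hδ, div_le_iff₀ (by positivity)]
    nlinarith [mul_le_mul_of_nonneg_left hden (sq_nonneg s), pow_pos hs 2]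
  have hball : ball z₀ δ ⊆ ball z₀ (s ^ 2 / 4) := ball_subset_ball hδle
  have hball' : ball z₀ δ ⊆ ball 0 1 :=
    ((hball.trans (ball_subset_ball (by nlinarith))).trans ball_subset_closedBall).trans hsub
  obtain ⟨Ω, hΩ, hopen, hconn, hbij⟩ := exists_bijOn_ball_of_fderiv_near (σ := σ) (by positivity)
    hδpos hexpand (fun w hw => hF.differentiableAt (hball' hw)) fun w hw => by
      refine (hF.norm_fderiv_sub_le ha hs hs1 hsub hB w (hball hw)).trans ?_
      have hw' : ‖w - z₀‖ ≤ δ := (mem_ball_iff_norm.1 hw).le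
      calc _ ≤ (m + 1) ^ 2 * (a / s ^ 4 * (K * (8 * M) * s)) * δ := by gcongr
        _ = σ / 2 := by rw [hδ, hσ]; field_simp; ring
  refine ⟨σ * δ / 4, ?_, Ω, F z₀, hΩ.trans hball', hopen, hconn, hbij⟩
  have hR : σ * δ / 4 = s ^ 3 * M * (1 / (64 * ((m + 1) ^ 2 * (a * K ^ (2 * m + 1))))) := by
    rw [hσ, hδ]
    field_simp
    ring
  rw [hR]
  calc _ = 1 / 64 * (1 / (64 * (((m : ℝ) + 1) ^ 2 * (a * K ^ (2 * m + 1))))) := by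
        field_simp; norm_num
    _ ≤ _ := by gcongr

end IsHeatBochnerTakahashi

lemma succ_sq_le_mul_two_pow (hm : 1 ≤ m) : (m + 1) ^ 2 ≤ m * 2 ^ (m + 1) := by
  induction m, hm using Nat.le_induction with
  | base => norm_num
  | succ n hn ih =>
    rw [pow_succ 2 (n + 1)]
    nlinarith [pow_pos (two_pos (α := ℕ)) (n + 1)]

lemma schlicht_radius_le (hm : 1 ≤ m) {a K : ℝ} (ha : 1 ≤ a) (hK : 1 ≤ K) :
    (0.22 : ℝ) ^ 4 / (2 ^ (m + 5) * (m : ℝ)) * (1 / (a ^ 4 * K ^ (2 * m + 3))) ≤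
      1 / (4096 * ((m + 1) ^ 2 * (a * K ^ (2 * m + 1)))) := by
  have hm' : ((m : ℝ) + 1) ^ 2 ≤ m * 2 ^ (m + 1) := by exact_mod_cast succ_sq_le_mul_two_pow hm
  have hQ : a * K ^ (2 * m + 1) ≤ a ^ 4 * K ^ (2 * m + 3) := by
    gcongr
    · exact le_self_pow₀ ha (by norm_num)
    · norm_num
  have hD : 16 * ((m : ℝ) + 1) ^ 2 ≤ 2 ^ (m + 5) * m := by
    rw [show m + 5 = (m + 1) + 4 by ring, pow_add]
    nlinarith
  calc _ ≤ (0.22 : ℝ) ^ 4 / (16 * ((m : ℝ) + 1) ^ 2) * (1 / (a * K ^ (2 * m + 1))) := by gcongr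
    _ = (0.22 : ℝ) ^ 4 / 16 * (1 / (((m : ℝ) + 1) ^ 2 * (a * K ^ (2 * m + 1)))) := by
        field_simp
    _ ≤ 1 / 4096 * (1 / (((m : ℝ) + 1) ^ 2 * (a * K ^ (2 * m + 1)))) := by
        refine mul_le_mul_of_nonneg_right ?_ (by positivity)
        norm_num
    _ = _ := by field_simp

end HeatBloch

open HeatBloch
theorem theorem2 (m : ℕ) (hm : 1 ≤ m) :
    (∃ a : ℝ, IsInteriorEstimateConstant m a) ∧
    ∀ a : ℝ, IsInteriorEstimateConstant m a →
      ∀ (K : ℝ) (F : SpaceTime m → SpaceTime m),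
        IsHeatBochnerTakahashi K F → |(jacobian F 0).det| = 1 →
        ∃ R : ℝ,
          (0.22 : ℝ) ^ 4 / (2 ^ (m + 5) * (m : ℝ)) * (1 / (a ^ 4 * K ^ (2 * m + 3))) ≤ R ∧
          CoversSchlichtDisk F R := by
  refine ⟨exists_isInteriorEstimateConstant hm, fun a ha K F hF h0 => ?_⟩
  obtain ⟨R, hR, hcover⟩ := hF.coversSchlichtDisk ha h0
  exact ⟨R, (schlicht_radius_le hm ha.one_le (hF.one_le h0)).trans hR, hcover⟩
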